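/- Let $n\in\mathbb{N}$, let $dV$ be Lebesgue measure on $\mathbb{C}^n$, and let $d\mu(z)=\pi^{-n}e^{-|z|^2}dV(z)$ be the normalized Gaussian measure. The Fock space $F^2=L^2(\mathbb{C}^n,d\mu)\cap H(\mathbb{C}^n)$ is the space of all entire functions on $\mathbb{C}^n$ that are square integrable with respect to $\mu$, and $P$ denotes the orthogonal projection of $L^2(\mathbb{C}^n,d\mu)$ onto $F^2$, $$PF(z)=\int_{\mathbb{C}^n}F(w)\,e^{z\cdot\overline{w}}\,d\mu(w),\qquad z\cdot\overline w=\sum_{i=1}^n z_i\overline{w_i}.$$ For a measurable function $a$ on $\mathbb{C}^n$, the Toeplitz operator $T_a$ is the (possibly unbounded) operator $T_ah=P(ah)$ on $F^2$ with domain $\{h\in F^2: ah\in L^2(\mathbb{C}^n,d\mu)\}$; the product $T_aT_b$ has domain $\{h\in\operatorname{dom}T_b: T_bh\in\operatorname{dom}T_a\}$, and $T_aT_b=0$ means that $T_aT_bh=0$ for every $h$ in this domain. Let $\mathrm{Sym}(\mathbb{C}^n)$ be the set of measurable $a:\mathbb{C}^n\to\mathbb{C}$ such that $a(z)e^{-c|z|^2}$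 is essentially bounded on $\mathbb{C}^n$ for every $c>0$. Let $f,g,u,v$ be entire functions in $\mathrm{Sym}(\mathbb{C}^n)$, and put $\varphi=f+\overline{g}$ and $\psi=u+\overline{v}$. Then $T_\varphi T_\psi=0$ if and only if $\varphi=0$ or $\psi=0$. -/

import Mathlib

open MeasureTheory
open scoped ComplexConjugate

noncomputable section

namespace Fock

/-- `|z|² = ∑ |z_i|²`; the Euclidean square norm, written out because `Fin n → ℂ` carries the
sup norm. -/
def normSq {n : ℕ} (z : Fin n → ℂ) : ℝ := ∑ i, ‖z i‖ ^ 2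

/-- The normalized Gaussian measure `dμ(z) = π⁻ⁿ exp(-|z|²) dV(z)` on `ℂⁿ`, where `dV` is
Lebesgue measure. -/
def gaussian (n : ℕ) : Measure (Fin n → ℂ) :=
  volume.withDensity fun z => ENNReal.ofReal ((1 / Real.pi ^ n) * Real.exp (-normSq z))

/-- The reproducing kernel `K(z, w) = exp(z · w̄)`. -/
def kernel {n : ℕ} (z w : Fin n → ℂ) : ℂ := Complex.exp (∑ i, z i * conj (w i))

/-- The Fock space `F² = L²(ℂⁿ, dμ) ∩ H(ℂⁿ)`. -/
def space (n : ℕ) : Submodule ℂ ((Fin n → ℂ) → ℂ) where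
  carrier := {h | Differentiable ℂ h ∧ MemLp h 2 (gaussian n)}
  add_mem' ha hb := ⟨ha.1.add hb.1, ha.2.add hb.2⟩
  zero_mem' := ⟨differentiable_const 0, MemLp.zero⟩
  smul_mem' c _ ha := ⟨ha.1.const_smul c, ha.2.const_smul c⟩

/-- The orthogonal projection of `L²(ℂⁿ, dμ)` onto `F²`,
`(P F)(z) = ∫ F(w) K(z, w) dμ(w)`; used only for `F ∈ L²(ℂⁿ, dμ)`, where the integral
converges absolutely for every `z`. -/
def projection {n : ℕ} (F : (Fin n → ℂ) → ℂ) : (Fin n → ℂ) → ℂ :=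
  fun z => ∫ w, F w * kernel z w ∂(gaussian n)

/-- `D_c`: measurable functions `a` on `ℂⁿ` such that `a(z) exp(-c|z|²)` is essentially
bounded. -/
def growthClass (n : ℕ) (c : ℝ) : Set ((Fin n → ℂ) → ℂ) :=
  {a | Measurable a ∧ ∃ C : ℝ, ∀ᵐ z : Fin n → ℂ, ‖a z‖ * Real.exp (-c * normSq z) ≤ C}

/-- `Sym(ℂⁿ) = ⋂_{c > 0} D_c`. -/
def symbolClass (n : ℕ) : Set ((Fin n → ℂ) → ℂ) := ⋂ (c : ℝ) (_ : 0 < c), growthClass n c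

/-- The natural domain in `F²` of the (in general unbounded) Toeplitz operator `T_a = P M_a`:
all `h ∈ F²` with `a h ∈ L²(ℂⁿ, dμ)`. -/
def toeplitzDomain {n : ℕ} (a : (Fin n → ℂ) → ℂ) : Submodule ℂ ((Fin n → ℂ) → ℂ) where
  carrier := {h | h ∈ space n ∧ MemLp (fun w => a w * h w) 2 (gaussian n)}
  add_mem' {x y} hx hy := ⟨(space n).add_mem hx.1 hy.1, by
    refine (hx.2.add hy.2).ae_eq (Filter.Eventually.of_forall fun w => ?_)
    simp only [Pi.add_apply, mul_add]⟩
  zero_mem' := ⟨(space n).zero_mem, by simp⟩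
  smul_mem' c x hx := ⟨(space n).smul_mem c hx.1, by
    have := hx.2.const_smul c
    refine this.ae_eq (Filter.Eventually.of_forall fun w => ?_)
    simp only [Pi.smul_apply, smul_eq_mul]
    ring⟩

/-- The Toeplitz operator `T_a h = P (a h)`, for `h` in `toeplitzDomain a`. -/
def toeplitz {n : ℕ} (a h : (Fin n → ℂ) → ℂ) : (Fin n → ℂ) → ℂ :=
  projection fun w => a w * h w

/-- The natural domain of the operator product `T_a T_b`. -/
def productDomain {n : ℕ} (a b : (Fin n → ℂ) → ℂ) : Set ((Fin n → ℂ) → ℂ) :=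
  {h | h ∈ toeplitzDomain b ∧ toeplitz b h ∈ toeplitzDomain a}

/-- `T_a T_b = 0` on `F²`: the product of the two operators vanishes on its natural domain. -/
def ToeplitzProductEqZero {n : ℕ} (a b : (Fin n → ℂ) → ℂ) : Prop :=
  ∀ h ∈ productDomain a b, toeplitz a (toeplitz b h) = 0

end Fock

end

namespace Fock

/-! Apply $T_\varphi T_\psi$ to the functions $K_w = K(\cdot,w)$, which lie in the product domain
because the symbols grow slowly. Dividing by $K(z,w)$ gives `kernel_identity`: $f(z)u(z) +
f(z)\overline{v(w)} + \overline{g(w)v(w)} + \int u(z+\zeta)\overline{g(w+\zeta)}\,d\mu(\zeta) = 0$.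
If the integral were $u(z)\overline{g(w)}$, the left side would factor as
$(f(z)+\overline{g(w)})(u(z)+\overline{v(w)})$, and the identity theorem would make one symbol
vanish. The integral does have this value when $u$ or $g$ is constant.

Averaging the identity over $(z+\xi, w-\xi)$ with Gaussian $\xi$ undoes the pairing of $u$ with $g$
and pairs $f$ with $v$ instead (`inverse_identity`); this settles the case of constant $v$.

There remains the case of nonconstant $g$ and $v$, where $u$ turns out to be constant. Differencing
the two identities in $w$ bounds $u$ by Gaussian averages of $f$ and $f$ by Gaussian averages of
$u$; the first identity at $w=0$ bounds $fu$ by averages of $u$. So $f$ and $u$ must be large near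
the same places while their product is no larger than one of them. Along a complex line, Jensen's
formula forbids this (`posLog_two_discs`), hence any bound $e^{\varepsilon|z|^2+K}$ with small
$\varepsilon$ improves by a fixed factor in the exponent (`growth_improvement`). Iterating makes $u$
bounded, and Liouville's theorem applies. -/

/-! ### The square norm and the reproducing kernel. -/

theorem normSq_nonneg {n : ℕ} (z : Fin n → ℂ) : 0 ≤ normSq z :=
  Finset.sum_nonneg fun _ _ => sq_nonneg _

@[simp] theorem normSq_zero {n : ℕ} : normSq (0 : Fin n → ℂ) = 0 := by simp [normSq]

theorem continuous_normSq {n : ℕ} : Continuous (normSq : (Fin n → ℂ) → ℝ) := by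
  unfold normSq; fun_prop

theorem normSq_smul {n : ℕ} (c : ℂ) (z : Fin n → ℂ) : normSq (c • z) = ‖c‖ ^ 2 * normSq z := by
  simp [normSq, Finset.mul_sum, mul_pow]

/-- Young's inequality for the square norm of a sum. -/
theorem normSq_add_le {n : ℕ} (x y : Fin n → ℂ) {a : ℝ} (ha : 0 < a) :
    normSq (x + y) ≤ (1 + a) * normSq x + (1 + a⁻¹) * normSq y := by
  simp only [normSq, Finset.mul_sum, ← Finset.sum_add_distrib]
  refine Finset.sum_le_sum fun i _ => ?_
  have h := norm_add_le (x i) (y i)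
  have h2 : ‖x i + y i‖ ^ 2 ≤ (‖x i‖ + ‖y i‖) ^ 2 := by gcongr
  have h3 : 0 ≤ a⁻¹ * (a * ‖x i‖ - ‖y i‖) ^ 2 := by positivity
  have h4 : a⁻¹ * (a * ‖x i‖ - ‖y i‖) ^ 2
      = a * ‖x i‖ ^ 2 - 2 * ‖x i‖ * ‖y i‖ + a⁻¹ * ‖y i‖ ^ 2 := by field_simp; ring
  simp only [Pi.add_apply]
  nlinarith

theorem norm_kernel_le {n : ℕ} (z w : Fin n → ℂ) {a : ℝ} (ha : 0 < a) :
    ‖kernel z w‖ ≤ Real.exp (a * normSq z + (4 * a)⁻¹ * normSq w) := by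
  rw [kernel, Complex.norm_exp, Real.exp_le_exp]
  refine (Complex.re_le_norm _).trans ((norm_sum_le _ _).trans ?_)
  simp only [normSq, Finset.mul_sum, ← Finset.sum_add_distrib]
  refine Finset.sum_le_sum fun i _ => ?_
  rw [norm_mul, RCLike.norm_conj]
  have h3 : 0 ≤ (4 * a)⁻¹ * (2 * a * ‖z i‖ - ‖w i‖) ^ 2 := by positivity
  have h4 : (4 * a)⁻¹ * (2 * a * ‖z i‖ - ‖w i‖) ^ 2
      = a * ‖z i‖ ^ 2 - ‖z i‖ * ‖w i‖ + (4 * a)⁻¹ * ‖w i‖ ^ 2 := by field_simp; ring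
  linarith

theorem conj_kernel {n : ℕ} (z w : Fin n → ℂ) : conj (kernel z w) = kernel w z := by
  simp only [kernel, ← Complex.exp_conj, map_sum, map_mul, Complex.conj_conj, mul_comm]

theorem kernel_ne_zero {n : ℕ} (z w : Fin n → ℂ) : kernel z w ≠ 0 := Complex.exp_ne_zero _

theorem kernel_add_left {n : ℕ} (z z' w : Fin n → ℂ) :
    kernel (z + z') w = kernel z w * kernel z' w := by
  simp [kernel, ← Complex.exp_add, add_mul, Finset.sum_add_distrib]

theorem kernel_add_right {n : ℕ} (z w w' : Fin n → ℂ) :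
    kernel z (w + w') = kernel z w * kernel z w' := by
  simp [kernel, ← Complex.exp_add, mul_add, Finset.sum_add_distrib]

theorem kernel_neg_left {n : ℕ} (z w : Fin n → ℂ) : kernel (-z) w = (kernel z w)⁻¹ := by
  simp [kernel, ← Complex.exp_neg]

theorem differentiable_kernel {n : ℕ} (w : Fin n → ℂ) :
    Differentiable ℂ fun z => kernel z w := by
  unfold kernel; fun_prop

theorem continuous_kernel {n : ℕ} :
    Continuous fun p : (Fin n → ℂ) × (Fin n → ℂ) => kernel p.1 p.2 := by
  unfold kernel
  have : Continuous (conj : ℂ → ℂ) := Complex.continuous_conj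
  fun_prop

/-! ### Functions of slow growth. -/

/-- The growth condition defining `Sym(ℂⁿ)`, required at every point. -/
def SlowGrowth {n : ℕ} (h : (Fin n → ℂ) → ℂ) : Prop :=
  ∀ c : ℝ, 0 < c → ∃ C : ℝ, ∀ z, ‖h z‖ ≤ C * Real.exp (c * normSq z)

/-- For continuous functions an almost everywhere bound holds on a dense set, and the set where it
holds is closed. -/
theorem slowGrowth_of_mem_symbolClass {n : ℕ} {h : (Fin n → ℂ) → ℂ} (hh : h ∈ symbolClass n)
    (hc : Continuous h) : SlowGrowth h := by
  intro c hc0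
  simp only [symbolClass, Set.mem_iInter] at hh
  obtain ⟨-, C, hC⟩ := hh c hc0
  refine ⟨C, fun z => ?_⟩
  have hd := Measure.dense_of_ae hC
  have hcl : IsClosed {z : Fin n → ℂ | ‖h z‖ * Real.exp (-c * normSq z) ≤ C} := by
    have := continuous_normSq (n := n)
    exact isClosed_le (by fun_prop) continuous_const
  have hz : z ∈ {z : Fin n → ℂ | ‖h z‖ * Real.exp (-c * normSq z) ≤ C} := by
    rw [← hcl.closure_eq]; exact hd z
  have hz' : ‖h z‖ * Real.exp (-c * normSq z) ≤ C := hz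
  rwa [neg_mul, Real.exp_neg, ← div_eq_mul_inv, div_le_iff₀ (Real.exp_pos _)] at hz'

namespace SlowGrowth

variable {n : ℕ} {h k : (Fin n → ℂ) → ℂ}

theorem exists_nonneg (hh : SlowGrowth h) {c : ℝ} (hc : 0 < c) :
    ∃ C : ℝ, 0 ≤ C ∧ ∀ z, ‖h z‖ ≤ C * Real.exp (c * normSq z) := by
  obtain ⟨C, hC⟩ := hh c hc
  refine ⟨C, ?_, hC⟩
  have := (norm_nonneg _).trans (hC 0)
  simpa using this

theorem const (a : ℂ) : SlowGrowth fun _ : Fin n → ℂ => a := fun _ hc =>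
  ⟨‖a‖, fun z => le_mul_of_one_le_right (norm_nonneg _)
    (Real.one_le_exp (mul_nonneg hc.le (normSq_nonneg z)))⟩

theorem add (hh : SlowGrowth h) (hk : SlowGrowth k) : SlowGrowth fun z => h z + k z := by
  intro c hc
  obtain ⟨C, hC⟩ := hh c hc
  obtain ⟨D, hD⟩ := hk c hc
  exact ⟨C + D, fun z => (norm_add_le _ _).trans (by rw [add_mul]; exact add_le_add (hC z) (hD z))⟩

theorem mul (hh : SlowGrowth h) (hk : SlowGrowth k) : SlowGrowth fun z => h z * k z := by
  intro c hc
  obtain ⟨C, hC0, hC⟩ := hh.exists_nonneg (half_pos hc)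
  obtain ⟨D, hD0, hD⟩ := hk.exists_nonneg (half_pos hc)
  refine ⟨C * D, fun z => ?_⟩
  rw [norm_mul]
  refine (mul_le_mul (hC z) (hD z) (norm_nonneg _) (by positivity)).trans (le_of_eq ?_)
  rw [mul_mul_mul_comm, ← Real.exp_add]
  ring_nf

theorem star (hh : SlowGrowth h) : SlowGrowth fun z => conj (h z) := by
  simpa only [SlowGrowth, RCLike.norm_conj] using hh

/-- A dilation by `s` multiplies the exponent by `‖s‖ ^ 2`, which is harmless because every `c > 0`
is available. The `+ 1` in the denominator covers `s = 0`. -/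
theorem comp_affine (hh : SlowGrowth h) (a : Fin n → ℂ) (s : ℂ) :
    SlowGrowth fun z => h (a + s • z) := by
  intro c hc
  have hs : 0 < 2 * ‖s‖ ^ 2 + 1 := by positivity
  obtain ⟨C, hC0, hC⟩ := hh.exists_nonneg (div_pos hc hs)
  refine ⟨C * Real.exp (c / (2 * ‖s‖ ^ 2 + 1) * (2 * normSq a)), fun z => (hC _).trans ?_⟩
  rw [mul_assoc, ← Real.exp_add]
  have h1 := normSq_add_le a (s • z) one_pos
  rw [normSq_smul] at h1
  have h2 := normSq_nonneg z
  refine mul_le_mul_of_nonneg_left (Real.exp_le_exp.2 ?_) hC0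
  have h3 : c / (2 * ‖s‖ ^ 2 + 1) * (2 * ‖s‖ ^ 2 + 1) = c := by field_simp
  have h4 : 0 < c / (2 * ‖s‖ ^ 2 + 1) := div_pos hc hs
  set d := c / (2 * ‖s‖ ^ 2 + 1)
  rw [← h3, mul_assoc, ← mul_add]
  refine mul_le_mul_of_nonneg_left ?_ h4.le
  norm_num at h1
  nlinarith

theorem comp_add_right (hh : SlowGrowth h) (a : Fin n → ℂ) : SlowGrowth fun z => h (z + a) := by
  simpa [add_comm] using hh.comp_affine a 1

theorem kernel (w : Fin n → ℂ) : SlowGrowth fun z => kernel z w := fun c hc =>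
  ⟨Real.exp ((4 * c)⁻¹ * normSq w), fun z => (norm_kernel_le z w hc).trans
    (by rw [← Real.exp_add, add_comm])⟩

theorem kernel_right (z : Fin n → ℂ) : SlowGrowth fun w => Fock.kernel z w := by
  simpa only [conj_kernel] using (kernel z).star

end SlowGrowth

/-! ### The Gaussian measure: integrability and translation. -/

theorem integrable_exp_neg_mul_normSq {n : ℕ} {c : ℝ} (hc : 0 < c) :
    Integrable fun z : Fin n → ℂ => Real.exp (-c * normSq z) := by
  have h1 : Integrable fun z : ℂ => Real.exp (-c * ‖z‖ ^ 2) := by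
    have := (GaussianFourier.integrable_cexp_neg_mul_sq_norm_add (V := ℂ) (b := (c : ℂ))
      (by simpa using hc) 0 0).re
    refine this.congr (Filter.Eventually.of_forall fun z => ?_)
    simp only [inner_zero_left, Complex.ofReal_zero, mul_zero, add_zero]
    have e : -(c : ℂ) * (‖z‖ : ℂ) ^ 2 = ((-c * ‖z‖ ^ 2 : ℝ) : ℂ) := by push_cast; ring
    rw [e]
    exact Complex.exp_ofReal_re _
  have h2 := Integrable.fintype_prod (ι := Fin n) (μ := fun _ => (volume : Measure ℂ))
    (f := fun _ z => Real.exp (-c * ‖z‖ ^ 2)) fun _ => h1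
  refine h2.congr (Filter.Eventually.of_forall fun z => ?_)
  simp [normSq, ← Real.exp_sum, Finset.mul_sum]

theorem integral_exp_neg_normSq (n : ℕ) :
    ∫ z : Fin n → ℂ, Real.exp (-normSq z) = Real.pi ^ n := by
  have h1 : ∫ z : ℂ, Real.exp (-1 * ‖z‖ ^ 2) = Real.pi := by
    rw [GaussianFourier.integral_rexp_neg_mul_sq_norm one_pos]
    simp
  have h2 := integral_fintype_prod_volume_eq_pow (ι := Fin n)
    (fun z : ℂ => Real.exp (-1 * ‖z‖ ^ 2))
  rw [h1, Fintype.card_fin] at h2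
  rw [← h2]
  congr 1 with z
  simp [normSq, ← Real.exp_sum]

/-- The density of the Gaussian measure. -/
noncomputable def density {n : ℕ} (z : Fin n → ℂ) : ℝ := (1 / Real.pi ^ n) * Real.exp (-normSq z)

theorem density_nonneg {n : ℕ} (z : Fin n → ℂ) : 0 ≤ density z := by
  unfold density; positivity

theorem continuous_density {n : ℕ} : Continuous (density : (Fin n → ℂ) → ℝ) := by
  have := continuous_normSq (n := n)
  unfold density; fun_prop

theorem measurable_ofReal_density {n : ℕ} :
    Measurable fun z : Fin n → ℂ => ENNReal.ofReal (density z) :=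
  continuous_density.measurable.ennreal_ofReal

theorem gaussian_eq (n : ℕ) :
    gaussian n = volume.withDensity fun z => ENNReal.ofReal (density z) := rfl

theorem integral_gaussian {n : ℕ} {E : Type*} [NormedAddCommGroup E] [NormedSpace ℝ E]
    (F : (Fin n → ℂ) → E) : ∫ z, F z ∂(gaussian n) = ∫ z, density z • F z := by
  rw [gaussian_eq, integral_withDensity_eq_integral_toReal_smul measurable_ofReal_density
    (Filter.Eventually.of_forall fun _ => ENNReal.ofReal_lt_top)]
  simp only [ENNReal.toReal_ofReal (density_nonneg _)]

theorem integrable_gaussian_iff {n : ℕ} {E : Type*} [NormedAddCommGroup E] [NormedSpace ℝ E]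
    {F : (Fin n → ℂ) → E} :
    Integrable F (gaussian n) ↔ Integrable fun z => density z • F z := by
  rw [gaussian_eq, integrable_withDensity_iff_integrable_smul' measurable_ofReal_density
    (Filter.Eventually.of_forall fun _ => ENNReal.ofReal_lt_top)]
  simp only [ENNReal.toReal_ofReal (density_nonneg _)]

theorem integrable_exp_mul_normSq {n : ℕ} {c : ℝ} (hc : c < 1) :
    Integrable (fun z => Real.exp (c * normSq z)) (gaussian n) := by
  rw [integrable_gaussian_iff]
  refine ((integrable_exp_neg_mul_normSq (n := n) (sub_pos.2 hc)).const_mul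
    (1 / Real.pi ^ n)).congr (Filter.Eventually.of_forall fun z => ?_)
  simp only [density, smul_eq_mul]
  rw [mul_assoc, ← Real.exp_add]
  ring_nf

instance isProbabilityMeasure_gaussian (n : ℕ) : IsProbabilityMeasure (gaussian n) := by
  have h1 : Integrable (fun _ : Fin n → ℂ => (1 : ℝ)) (gaussian n) := by
    simpa using integrable_exp_mul_normSq (n := n) (c := 0) one_pos
  have h2 : ∫ _ : Fin n → ℂ, (1 : ℝ) ∂(gaussian n) = 1 := by
    rw [integral_gaussian]
    simp only [density, smul_eq_mul, mul_one]
    rw [integral_const_mul, integral_exp_neg_normSq]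
    field_simp
  have h3 : IsFiniteMeasure (gaussian n) := by
    simpa [integrable_const_iff] using h1
  refine ⟨?_⟩
  rw [integral_const, smul_eq_mul, mul_one, measureReal_def] at h2
  rw [← ENNReal.ofReal_toReal (measure_ne_top (gaussian n) _), h2, ENNReal.ofReal_one]

theorem SlowGrowth.integrable {n : ℕ} {h : (Fin n → ℂ) → ℂ} (hh : SlowGrowth h)
    (hc : Continuous h) : Integrable h (gaussian n) := by
  obtain ⟨C, hC⟩ := hh (1 / 2) (by norm_num)
  exact ((integrable_exp_mul_normSq (c := 1 / 2) (by norm_num)).const_mul C).mono'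
    hc.aestronglyMeasurable (Filter.Eventually.of_forall hC)

theorem SlowGrowth.memLp {n : ℕ} {h : (Fin n → ℂ) → ℂ} (hh : SlowGrowth h)
    (hc : Continuous h) : MemLp h 2 (gaussian n) := by
  rw [memLp_two_iff_integrable_sq_norm hc.aestronglyMeasurable]
  have := ((hh.mul hh).integrable (by fun_prop)).norm
  simpa [sq] using this

/-- The expansion $|z+a|^2 = |z|^2 + z\cdot\bar a + a\cdot\bar z + |a|^2$ turns the shifted density
into the density times inverse kernels. -/
theorem integral_gaussian_add {n : ℕ} (F : (Fin n → ℂ) → ℂ) (a : Fin n → ℂ) :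
    ∫ z, F z ∂(gaussian n)
      = ∫ z, F (z + a) * (kernel z a * kernel a z * kernel a a)⁻¹ ∂(gaussian n) := by
  rw [integral_gaussian, integral_gaussian, ← integral_add_right_eq_self _ a]
  congr 1 with z
  have h1 : ((density (z + a) : ℝ) : ℂ)
      = density z * (kernel z a * kernel a z * kernel a a)⁻¹ := by
    simp only [density, kernel, ← Complex.exp_add, ← Complex.exp_neg]
    push_cast
    rw [mul_assoc, ← Complex.exp_add]
    congr 2
    have h2 : ∀ x : Fin n → ℂ, ((normSq x : ℝ) : ℂ) = ∑ i, x i * conj (x i) := by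
      intro x
      simp [normSq, Complex.mul_conj, Complex.normSq_eq_norm_sq]
    rw [h2, h2]
    simp only [← Finset.sum_add_distrib, ← Finset.sum_neg_distrib, Pi.add_apply, map_add]
    refine Finset.sum_congr rfl fun i _ => ?_
    ring
  rw [Complex.real_smul, Complex.real_smul, h1]
  ring

/-! ### Rotation invariance, the mean value property and the reproducing property. -/

/-- Integration against a rotation invariant measure may be preceded by averaging over circles. -/
theorem integral_eq_integral_circleAverage {E G : Type*} [NormedAddCommGroup E] [NormedSpace ℂ E]
    [MeasurableSpace E] [BorelSpace E] [SecondCountableTopology E] [NormedAddCommGroup G]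
    [NormedSpace ℝ G] [CompleteSpace G] {ν : Measure E} [SFinite ν]
    (hν : ∀ c : ℂ, ‖c‖ = 1 → MeasurePreserving (fun x : E => c • x) ν ν) {F : E → G}
    (hF : Continuous F) (hFi : Integrable F ν) :
    ∫ x, F x ∂ν = ∫ x, Real.circleAverage (fun t => F (t • x)) 0 1 ∂ν := by
  have hpi : (0 : ℝ) ≤ 2 * Real.pi := by positivity
  have hm : ∀ θ : ℝ, MeasurePreserving (fun x : E => circleMap 0 1 θ • x) ν ν := fun θ =>
    hν _ (by simp)
  have hme : ∀ θ : ℝ, MeasurableEmbedding (fun x : E => circleMap 0 1 θ • x) := fun θ =>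
    (Homeomorph.smulOfNeZero (circleMap 0 1 θ)
      (circleMap_ne_center one_ne_zero)).measurableEmbedding
  have hi : Integrable (Function.uncurry fun (θ : ℝ) (x : E) => F (circleMap 0 1 θ • x))
      ((volume.restrict (Set.Ioc 0 (2 * Real.pi))).prod ν) := by
    rw [integrable_prod_iff]
    · refine ⟨Filter.Eventually.of_forall fun θ => ?_, ?_⟩
      · exact (hm θ).integrable_comp_of_integrable hFi
      · have : ∀ θ : ℝ, ∫ x, ‖F (circleMap 0 1 θ • x)‖ ∂ν = ∫ x, ‖F x‖ ∂ν := fun θ =>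
          (hm θ).integral_comp (hme θ) fun x => ‖F x‖
        simp only [Function.uncurry_apply_pair, this]
        exact integrable_const _
    · refine Continuous.aestronglyMeasurable ?_
      have : Continuous fun p : ℝ × E => circleMap 0 1 p.1 := by fun_prop
      exact hF.comp (this.smul continuous_snd)
  have hsw := integral_integral_swap hi
  have hl : ∀ θ : ℝ, ∫ x, F (circleMap 0 1 θ • x) ∂ν = ∫ x, F x ∂ν := fun θ =>
    (hm θ).integral_comp (hme θ) F
  simp only [hl] at hsw
  simp only [Real.circleAverage_def, intervalIntegral.integral_of_le hpi]
  rw [integral_smul, ← hsw]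
  rw [setIntegral_const, Real.volume_real_Ioc_of_le hpi, sub_zero, smul_smul,
    inv_mul_cancel₀ (by positivity), one_smul]

theorem measurePreserving_smul_volume {n : ℕ} {c : ℂ} (hc : ‖c‖ = 1) :
    MeasurePreserving (fun x : Fin n → ℂ => c • x) := by
  have h1 : MeasurePreserving (fun x : ℂ => c * x) := by
    let e : ℂ ≃ₗᵢ[ℝ] ℂ := rotation ⟨c, mem_sphere_zero_iff_norm.2 hc⟩
    exact e.measurePreserving
  exact volume_preserving_pi (ι := Fin n) (f := fun _ x => c * x) fun _ => h1

theorem measurePreserving_smul_gaussian {n : ℕ} {c : ℂ} (hc : ‖c‖ = 1) :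
    MeasurePreserving (fun x : Fin n → ℂ => c • x) (gaussian n) (gaussian n) := by
  have h1 := measurePreserving_smul_volume (n := n) hc
  refine ⟨h1.measurable, Measure.ext fun s hs => ?_⟩
  rw [Measure.map_apply h1.measurable hs, gaussian_eq, withDensity_apply _ hs,
    withDensity_apply _ (h1.measurable hs), ← h1.setLIntegral_comp_preimage hs
      measurable_ofReal_density]
  simp [density, normSq_smul, hc]

/-- The mean value property of entire functions with respect to the Gaussian measure. -/
theorem integral_gaussian_of_differentiable {n : ℕ} {h : (Fin n → ℂ) → ℂ}
    (hd : Differentiable ℂ h) (hh : SlowGrowth h) : ∫ z, h z ∂(gaussian n) = h 0 := by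
  rw [integral_eq_integral_circleAverage (fun c hc => measurePreserving_smul_gaussian hc)
    hd.continuous (hh.integrable hd.continuous)]
  have : ∀ x : Fin n → ℂ, Real.circleAverage (fun t : ℂ => h (t • x)) 0 1 = h 0 := by
    intro x
    have hx : Differentiable ℂ fun t : ℂ => h (t • x) :=
      hd.comp (differentiable_id.smul_const x)
    rw [DiffContOnCl.circleAverage hx.diffContOnCl, zero_smul]
  simp [this]

/-- The reproducing property of the kernel. -/
theorem integral_mul_kernel {n : ℕ} {h : (Fin n → ℂ) → ℂ} (hd : Differentiable ℂ h)
    (hh : SlowGrowth h) (z : Fin n → ℂ) : ∫ w, h w * kernel z w ∂(gaussian n) = h z := by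
  rw [integral_gaussian_add _ z]
  have h1 : ∀ w : Fin n → ℂ,
      h (w + z) * kernel z (w + z) * (kernel w z * kernel z w * kernel z z)⁻¹
        = h (w + z) * kernel w (-z) := by
    intro w
    have h2 : kernel w (-z) = (kernel w z)⁻¹ := by
      rw [← conj_kernel, kernel_neg_left, map_inv₀, conj_kernel]
    rw [kernel_add_right, h2]
    have := kernel_ne_zero z w
    have := kernel_ne_zero z z
    have := kernel_ne_zero w z
    field_simp
  simp only [h1]
  have hd' : Differentiable ℂ fun w => h (w + z) * kernel w (-z) :=
    (hd.comp (differentiable_id.add_const z)).mul (differentiable_kernel (-z))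
  rw [integral_gaussian_of_differentiable hd' ((hh.comp_add_right z).mul (.kernel _))]
  simp [kernel]

theorem integral_conj_mul_kernel {n : ℕ} {h : (Fin n → ℂ) → ℂ} (hd : Differentiable ℂ h)
    (hh : SlowGrowth h) (z : Fin n → ℂ) :
    ∫ w, conj (h w) * kernel w z ∂(gaussian n) = conj (h z) := by
  rw [← integral_mul_kernel hd hh z, ← integral_conj]
  simp [conj_kernel]

/-! ### Gaussian pairings of translates. -/

/-- On slowly growing entire functions, the adjoint of translation by `a` is multiplication by
the kernel function at `a`. -/
theorem integral_translate_mul_conj {n : ℕ} {U G : (Fin n → ℂ) → ℂ} (hU : Differentiable ℂ U)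
    (hUs : SlowGrowth U) (hG : Differentiable ℂ G) (hGs : SlowGrowth G) (a : Fin n → ℂ) :
    ∫ ζ, U (ζ + a) * conj (G ζ) ∂(gaussian n)
      = ∫ η, U η * kernel a η * conj (G η) ∂(gaussian n) := by
  have hUa : SlowGrowth fun η => U η * kernel a η := hUs.mul (.kernel_right a)
  have hcont : Continuous fun p : (Fin n → ℂ) × (Fin n → ℂ) =>
      conj (G p.1) * (U p.2 * kernel (p.1 + a) p.2) := by
    have h1 : Continuous fun p : (Fin n → ℂ) × (Fin n → ℂ) => kernel (p.1 + a) p.2 :=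
      continuous_kernel.comp (by fun_prop : Continuous fun p : (Fin n → ℂ) × (Fin n → ℂ) =>
        (p.1 + a, p.2))
    have h2 := hU.continuous
    exact (Complex.continuous_conj.comp (hG.continuous.comp continuous_fst)).mul
      ((h2.comp continuous_snd).mul h1)
  have hi : Integrable (Function.uncurry fun ζ η : Fin n → ℂ =>
      conj (G ζ) * (U η * kernel (ζ + a) η)) ((gaussian n).prod (gaussian n)) := by
    -- The kernel costs exponent `1 / 2` in each variable, so growth `1 / 4` of the other factors
    -- gives `3 / 4 < 1`, still integrable against the Gaussian.
    obtain ⟨C, hC0, hC⟩ := hGs.exists_nonneg (c := 1 / 4) (by norm_num)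
    obtain ⟨D, hD0, hD⟩ := hUa.exists_nonneg (c := 1 / 4) (by norm_num)
    have hexp := integrable_exp_mul_normSq (n := n) (c := 3 / 4) (by norm_num)
    have he := (hexp.const_mul C).mul_prod (hexp.const_mul D)
    refine he.mono' hcont.aestronglyMeasurable (Filter.Eventually.of_forall fun p => ?_)
    obtain ⟨ζ, η⟩ := p
    simp only [Function.uncurry_apply_pair]
    rw [norm_mul, RCLike.norm_conj, kernel_add_left]
    have h1 : ‖U η * (kernel ζ η * kernel a η)‖ ≤ (D * Real.exp (1 / 4 * normSq η))
        * Real.exp (1 / 2 * normSq ζ + 1 / 2 * normSq η) := by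
      have h2 := norm_kernel_le ζ η (a := 1 / 2) (by norm_num)
      norm_num at h2
      rw [mul_comm (kernel ζ η), ← mul_assoc, norm_mul]
      refine mul_le_mul (hD η) (h2.trans_eq (by norm_num)) (norm_nonneg _) (by positivity)
    refine (mul_le_mul (hC ζ) h1 (norm_nonneg _) (by positivity)).trans_eq ?_
    have e1 : Real.exp (3 / 4 * normSq ζ)
        = Real.exp (1 / 4 * normSq ζ) * Real.exp (1 / 2 * normSq ζ) := by
      rw [← Real.exp_add]; ring_nf
    have e2 : Real.exp (3 / 4 * normSq η)
        = Real.exp (1 / 4 * normSq η) * Real.exp (1 / 2 * normSq η) := by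
      rw [← Real.exp_add]; ring_nf
    rw [e1, e2, Real.exp_add]
    ring
  calc ∫ ζ, U (ζ + a) * conj (G ζ) ∂(gaussian n)
      = ∫ ζ, ∫ η, conj (G ζ) * (U η * kernel (ζ + a) η) ∂(gaussian n) ∂(gaussian n) := by
        congr 1 with ζ
        rw [integral_const_mul, integral_mul_kernel hU hUs, mul_comm]
    _ = ∫ η, ∫ ζ, conj (G ζ) * (U η * kernel (ζ + a) η) ∂(gaussian n) ∂(gaussian n) :=
        integral_integral_swap hi
    _ = _ := by
        congr 1 with η
        have : ∀ ζ : Fin n → ℂ, conj (G ζ) * (U η * kernel (ζ + a) η)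
            = U η * kernel a η * (conj (G ζ) * kernel ζ η) := fun ζ => by
          rw [kernel_add_left]; ring
        simp only [this]
        rw [integral_const_mul, integral_conj_mul_kernel hG hGs]

/-- The kernel of `T_{u ḡ}`: the pairing of translates of `u` and `g`. -/
theorem integral_mul_conj_mul_kernel {n : ℕ} {u g : (Fin n → ℂ) → ℂ} (hu : Differentiable ℂ u)
    (hus : SlowGrowth u) (hg : Differentiable ℂ g) (hgs : SlowGrowth g) (z w : Fin n → ℂ) :
    ∫ ζ, u ζ * conj (g ζ) * kernel ζ w * kernel z ζ ∂(gaussian n)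
      = kernel z w * ∫ ζ, u (ζ + z) * conj (g (ζ + w)) ∂(gaussian n) := by
  -- The shift `z - w` is chosen so that its kernel factor, times the conjugate of `K_w`, is `kernel
  -- z ζ`. A translation of the measure by `w` then removes the two copies of `K_w`.
  have h := integral_translate_mul_conj (hu.mul (differentiable_kernel w)) (hus.mul (.kernel w))
    (hg.mul (differentiable_kernel w)) (hgs.mul (.kernel w)) (z - w)
  have e1 : ∀ ζ : Fin n → ℂ, u ζ * kernel ζ w * kernel (z - w) ζ * conj (g ζ * kernel ζ w)
      = u ζ * conj (g ζ) * kernel ζ w * kernel z ζ := fun ζ => by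
    have : kernel (z - w) ζ * kernel w ζ = kernel z ζ := by
      rw [← kernel_add_left, sub_add_cancel]
    rw [map_mul, conj_kernel, ← this]
    ring
  simp only [Pi.mul_apply, e1] at h
  rw [← h, integral_gaussian_add _ w, ← integral_const_mul]
  congr 1 with ζ
  have e2 : ζ + w + (z - w) = ζ + z := by abel
  rw [map_mul, conj_kernel, e2, kernel_add_left ζ z w, kernel_add_right w ζ w]
  have := kernel_ne_zero ζ w
  have := kernel_ne_zero w ζ
  have := kernel_ne_zero w w
  field_simp

/-! ### Rotating a pair of Gaussian variables, and inverting the pairing. -/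

/-- The involution `(ζ, ξ) ↦ ((ζ + ξ) / √2, (ζ - ξ) / √2)`. -/
noncomputable def halfTurn (n : ℕ) :
    ((Fin n → ℂ) × (Fin n → ℂ)) →ₗ[ℝ] ((Fin n → ℂ) × (Fin n → ℂ)) :=
  ((√2)⁻¹ : ℝ) • ((LinearMap.fst ℝ _ _ + LinearMap.snd ℝ _ _).prod
    (LinearMap.fst ℝ _ _ - LinearMap.snd ℝ _ _))

theorem halfTurn_apply {n : ℕ} (p : (Fin n → ℂ) × (Fin n → ℂ)) :
    halfTurn n p = (((√2)⁻¹ : ℝ) • (p.1 + p.2), ((√2)⁻¹ : ℝ) • (p.1 - p.2)) := rfl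

theorem halfTurn_comp_self (n : ℕ) : halfTurn n ∘ₗ halfTurn n = LinearMap.id := by
  have h2 : (√2)⁻¹ * (√2)⁻¹ = (2 : ℝ)⁻¹ := by rw [← mul_inv, Real.mul_self_sqrt zero_le_two]
  refine LinearMap.ext fun p => ?_
  simp only [LinearMap.comp_apply, halfTurn_apply, LinearMap.id_apply, ← smul_add, ← smul_sub,
    smul_smul, h2]
  refine Prod.ext ?_ ?_ <;> ext i <;> simp <;> ring

theorem normSq_halfTurn {n : ℕ} (p : (Fin n → ℂ) × (Fin n → ℂ)) :
    normSq (halfTurn n p).1 + normSq (halfTurn n p).2 = normSq p.1 + normSq p.2 := by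
  have h2 : ((√2)⁻¹) ^ 2 = (2 : ℝ)⁻¹ := by rw [inv_pow, Real.sq_sqrt zero_le_two]
  simp only [halfTurn_apply, normSq, ← Finset.sum_add_distrib]
  refine Finset.sum_congr rfl fun i _ => ?_
  have h3 := parallelogram_law_with_norm ℝ (p.1 i) (p.2 i)
  simp only [Pi.smul_apply, Pi.add_apply, Pi.sub_apply, norm_smul, mul_pow, norm_inv,
    Real.norm_eq_abs, abs_of_nonneg (Real.sqrt_nonneg 2), h2]
  nlinarith

theorem measurePreserving_halfTurn_volume (n : ℕ) :
    MeasurePreserving (halfTurn n) ((volume : Measure (Fin n → ℂ)).prod volume)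
      ((volume : Measure (Fin n → ℂ)).prod volume) := by
  have hdet : LinearMap.det (halfTurn n) * LinearMap.det (halfTurn n) = 1 := by
    rw [← LinearMap.det_comp, halfTurn_comp_self, LinearMap.det_id]
  have hne : LinearMap.det (halfTurn n) ≠ 0 := left_ne_zero_of_mul_eq_one hdet
  have habs : |LinearMap.det (halfTurn n)| = 1 := by
    rcases mul_self_eq_one_iff.1 hdet with h | h <;> simp [h]
  have hH := Measure.prod.instIsAddHaarMeasure (volume : Measure (Fin n → ℂ))
    (volume : Measure (Fin n → ℂ))
  refine ⟨(LinearMap.continuous_of_finiteDimensional _).measurable, ?_⟩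
  rw [Measure.map_linearMap_addHaar_eq_smul_addHaar _ hne, abs_inv, habs]
  simp

theorem measurePreserving_halfTurn_gaussian (n : ℕ) :
    MeasurePreserving (halfTurn n) ((gaussian n).prod (gaussian n))
      ((gaussian n).prod (gaussian n)) := by
  have h1 := measurePreserving_halfTurn_volume n
  have hm : Measurable fun p : (Fin n → ℂ) × (Fin n → ℂ) =>
      ENNReal.ofReal (density p.1) * ENNReal.ofReal (density p.2) :=
    (measurable_ofReal_density.comp measurable_fst).mul
      (measurable_ofReal_density.comp measurable_snd)
  refine ⟨h1.measurable, Measure.ext fun s hs => ?_⟩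
  rw [Measure.map_apply h1.measurable hs, gaussian_eq,
    prod_withDensity measurable_ofReal_density measurable_ofReal_density,
    withDensity_apply _ hs, withDensity_apply _ (h1.measurable hs),
    ← h1.setLIntegral_comp_preimage hs hm]
  congr 1 with p
  rw [← ENNReal.ofReal_mul (density_nonneg _), ← ENNReal.ofReal_mul (density_nonneg _)]
  simp only [density]
  rw [mul_mul_mul_comm, ← Real.exp_add, mul_mul_mul_comm, ← Real.exp_add, ← neg_add, ← neg_add,
    normSq_halfTurn]

/-- Averaging the pairing of `u (· + z + ξ)` and `g (· + w - ξ)` over `ξ` recovers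
`u z * conj (g w)`. -/
theorem integral_integral_translate {n : ℕ} {u g : (Fin n → ℂ) → ℂ} (hu : Differentiable ℂ u)
    (hus : SlowGrowth u) (hg : Differentiable ℂ g) (hgs : SlowGrowth g) (z w : Fin n → ℂ) :
    ∫ ξ, ∫ ζ, u (ζ + (z + ξ)) * conj (g (ζ + (w - ξ))) ∂(gaussian n) ∂(gaussian n)
      = u z * conj (g w) := by
  -- Up to the factor `√2`, `ζ + ξ` and `ζ - ξ` are independent standard Gaussians, so the double
  -- integral splits into two mean values.
  set U : (Fin n → ℂ) → ℂ := fun ζ => u (z + ((√2 : ℝ) : ℂ) • ζ) with hU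
  set G : (Fin n → ℂ) → ℂ := fun ζ => g (w + ((√2 : ℝ) : ℂ) • ζ) with hG
  have hUd : Differentiable ℂ U := by
    simp only [hU]; fun_prop
  have hGd : Differentiable ℂ G := by
    simp only [hG]; fun_prop
  have hUs : SlowGrowth U := hus.comp_affine z _
  have hGs : SlowGrowth G := hgs.comp_affine w _
  have hGc : Continuous fun ζ => conj (G ζ) := Complex.continuous_conj.comp hGd.continuous
  have hi := (hUs.integrable hUd.continuous).mul_prod (hGs.star.integrable hGc)
  have hmp := measurePreserving_halfTurn_gaussian n
  have hcomp : ∀ p : (Fin n → ℂ) × (Fin n → ℂ),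
      U (halfTurn n p).1 * conj (G (halfTurn n p).2)
        = u (p.1 + (z + p.2)) * conj (g (p.1 + (w - p.2))) := by
    intro p
    have h2 : √2 * (√2)⁻¹ = (1 : ℝ) := mul_inv_cancel₀ (by positivity)
    have h3 : ∀ x : Fin n → ℂ, ((√2 : ℝ) : ℂ) • (((√2)⁻¹ : ℝ) • x) = x := fun x => by
      rw [Complex.coe_smul, smul_smul, h2, one_smul]
    simp only [hU, hG, halfTurn_apply, h3]
    rw [show z + (p.1 + p.2) = p.1 + (z + p.2) by abel,
      show w + (p.1 - p.2) = p.1 + (w - p.2) by abel]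
  have hemb : MeasurableEmbedding (halfTurn n) :=
    (LinearEquiv.ofInvolutive (halfTurn n) (LinearMap.congr_fun
      (halfTurn_comp_self n))).toContinuousLinearEquiv.toHomeomorph.measurableEmbedding
  have h1 := hmp.integral_comp hemb fun p => U p.1 * conj (G p.2)
  have h2 := (hmp.integrable_comp_of_integrable hi)
  simp only [hcomp, Function.comp_def] at h1 h2
  rw [integral_prod_mul U fun ζ => conj (G ζ), integral_conj,
    integral_gaussian_of_differentiable hUd hUs,
    integral_gaussian_of_differentiable hGd hGs] at h1
  simp only [hU, hG, smul_zero, add_zero] at h1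
  rw [← h1, integral_prod_symm _ h2]

/-! ### Jensen's formula and the two-disc estimate. -/

theorem posLog_le_of_le_exp {x A : ℝ} (hx : 0 ≤ x) (hA : 0 ≤ A) (h : x ≤ Real.exp A) :
    Real.posLog x ≤ A := by
  refine (Real.posLog_le_posLog hx h).trans ?_
  rw [Real.posLog_apply, Real.log_exp, max_eq_right hA]

/-- When one factor is below 1 its `posLog` is zero and the product bound says nothing about the
other; hence the separate bounds on `x` and `y`. -/
theorem posLog_add_posLog_le {x y P : ℝ} (hx : 0 ≤ x) (hy : 0 ≤ y) (hP : 0 ≤ P)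
    (hxP : x ≤ Real.exp P) (hyP : y ≤ Real.exp P) (h : x * y ≤ Real.exp P) :
    Real.posLog x + Real.posLog y ≤ P := by
  rcases le_or_gt x 1 with h1 | h1
  · rw [(Real.posLog_eq_zero_iff x).2 (by rwa [abs_of_nonneg hx]), zero_add]
    exact posLog_le_of_le_exp hy hP hyP
  rcases le_or_gt y 1 with h2 | h2
  · rw [(Real.posLog_eq_zero_iff y).2 (by rwa [abs_of_nonneg hy]), add_zero]
    exact posLog_le_of_le_exp hx hP hxP
  rw [Real.posLog_eq_log (by rw [abs_of_nonneg hx]; exact h1.le),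
    Real.posLog_eq_log (by rw [abs_of_nonneg hy]; exact h2.le),
    ← Real.log_mul (by positivity) (by positivity)]
  exact (Real.log_le_iff_le_exp (by positivity)).2 h

/-- `log⁺ |b|` satisfies the sub-mean value inequality on the unit circle. -/
theorem log_norm_le_circleAverage_posLog {b : ℂ → ℂ} (hb : Differentiable ℂ b) :
    Real.log ‖b 0‖ ≤ Real.circleAverage (fun t => Real.posLog ‖b t‖) 0 1 := by
  have hcont : Continuous fun t => Real.posLog ‖b t‖ :=
    Real.continuous_posLog.comp hb.continuous.norm
  have hci : CircleIntegrable (fun t => Real.posLog ‖b t‖) 0 1 :=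
    hcont.continuousOn.circleIntegrable zero_le_one
  have han : AnalyticOnNhd ℂ b (Metric.closedBall 0 |1|) := fun z _ => hb.analyticAt z
  by_cases h0 : b 0 = 0
  -- Here `Real.log 0 = 0`, so nonnegativity of the average suffices.
  · rw [h0, norm_zero, Real.log_zero]
    exact Real.circleAverage_nonneg_of_nonneg fun _ _ => Real.posLog_nonneg
  have hJ := AnalyticOnNhd.circleAverage_log_norm one_ne_zero han h0
  -- The zeros of `b` enter Jensen's formula with nonnegative multiplicity and weight `log (1 / ‖u‖)
  -- ≥ 0` in the unit disc.
  have hsum : 0 ≤ ∑ᶠ u : ℂ, (MeromorphicOn.divisor b (Metric.closedBall 0 |1|) u : ℝ)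
      * Real.log (1 * ‖0 - u‖⁻¹) := by
    refine finsum_nonneg fun u => ?_
    by_cases hu : u ∈ Metric.closedBall (0 : ℂ) |1|
    · refine mul_nonneg ?_ ?_
      · exact_mod_cast (MeromorphicOn.AnalyticOnNhd.divisor_nonneg han) u
      · have hu1 : ‖u‖ ≤ 1 := by simpa using hu
        rw [one_mul, zero_sub, norm_neg, Real.log_inv]
        exact neg_nonneg.2 (Real.log_nonpos (norm_nonneg _) hu1)
    · rw [Function.locallyFinsuppWithin.apply_eq_zero_of_notMem _ hu]
      simp
  have hmono : Real.circleAverage (fun t => Real.log ‖b t‖) 0 1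
      ≤ Real.circleAverage (fun t => Real.posLog ‖b t‖) 0 1 := by
    refine Real.circleAverage_mono ?_ hci fun x _ => le_max_right _ _
    exact MeromorphicOn.circleIntegrable_log_norm fun z _ => (hb.analyticAt z).meromorphicAt
  linarith

/-- `log⁺ |a|` satisfies the sub-mean value inequality on discs. -/
theorem log_norm_mul_le_setIntegral_posLog {a : ℂ → ℂ} (ha : Differentiable ℂ a) (c : ℂ) {R : ℝ}
    (hR : 0 ≤ R) :
    R ^ 2 * Real.pi * Real.log ‖a c‖ ≤ ∫ t in Metric.ball c R, Real.posLog ‖a t‖ := by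
  have hcont : Continuous fun t => Real.posLog ‖a t‖ :=
    Real.continuous_posLog.comp ha.continuous.norm
  have hcont' : Continuous fun t => Real.posLog ‖a (c + t)‖ :=
    hcont.comp (continuous_const.add continuous_id)
  have hvol : volume.real (Metric.ball (0 : ℂ) R) = R ^ 2 * Real.pi := by
    rw [measureReal_def, Complex.volume_ball]
    simp [ENNReal.toReal_ofReal hR]
  have hshift : ∫ t in Metric.ball c R, Real.posLog ‖a t‖
      = ∫ t in Metric.ball (0 : ℂ) R, Real.posLog ‖a (c + t)‖ := by
    have h1 := (measurePreserving_add_left (volume : Measure ℂ) c).setIntegral_preimage_emb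
      (Homeomorph.addLeft c).measurableEmbedding (fun t => Real.posLog ‖a t‖) (Metric.ball c R)
    rw [← h1]
    congr 2
    ext t
    simp
  have hrot : ∀ s : ℂ, ‖s‖ = 1 → MeasurePreserving (fun x : ℂ => s • x)
      (volume.restrict (Metric.ball 0 R)) (volume.restrict (Metric.ball 0 R)) := by
    intro s hs
    have h1 : MeasurePreserving (fun x : ℂ => s • x) := by
      let e : ℂ ≃ₗᵢ[ℝ] ℂ := rotation ⟨s, mem_sphere_zero_iff_norm.2 hs⟩
      exact e.measurePreserving
    have h2 := h1.restrict_preimage (s := Metric.ball 0 R) measurableSet_ball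
    have h3 : (fun x : ℂ => s • x) ⁻¹' Metric.ball 0 R = Metric.ball 0 R := by
      ext x; simp [hs]
    rwa [h3] at h2
  have hInt : Integrable (fun t => Real.posLog ‖a (c + t)‖)
      (volume.restrict (Metric.ball 0 R)) :=
    (hcont'.continuousOn.integrableOn_compact (isCompact_closedBall (0 : ℂ) R)).mono_set
      Metric.ball_subset_closedBall
  have havg : ∀ x : ℂ, Real.log ‖a c‖
      ≤ Real.circleAverage (fun t => Real.posLog ‖a (c + t • x)‖) 0 1 := by
    intro x
    have := log_norm_le_circleAverage_posLog (b := fun t => a (c + t • x)) (by fun_prop)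
    simpa using this
  rw [hshift, integral_eq_integral_circleAverage hrot hcont' hInt, ← hvol]
  have hfin : IsFiniteMeasure (volume.restrict (Metric.ball (0 : ℂ) R)) :=
    isFiniteMeasure_restrict.2 measure_ball_lt_top.ne
  have hconst : volume.real (Metric.ball (0 : ℂ) R) * Real.log ‖a c‖
      = ∫ _ in Metric.ball (0 : ℂ) R, Real.log ‖a c‖ := by
    rw [setIntegral_const, smul_eq_mul]
  rw [hconst]
  refine setIntegral_mono_on (integrable_const _) ?_ measurableSet_ball fun x _ => havg x
  have hc2 : Continuous fun x => Real.circleAverage (fun t => Real.posLog ‖a (c + t • x)‖) 0 1 := by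
    simp only [Real.circleAverage_def]
    refine Continuous.const_smul ?_ ((2 * Real.pi)⁻¹)
    refine intervalIntegral.continuous_parametric_intervalIntegral_of_continuous' ?_ _ _
    refine hcont'.comp ?_
    have : Continuous fun p : ℂ × ℝ => circleMap 0 1 p.2 := by fun_prop
    exact this.mul continuous_fst
  exact (hc2.continuousOn.integrableOn_compact (isCompact_closedBall (0 : ℂ) R)).mono_set
    Metric.ball_subset_closedBall

/-- Two entire functions of size at most `e^A`, one nearly of that size at `1` and the other
nearly of that size at `0`, cannot have a small product. -/
theorem posLog_two_discs {a b : ℂ → ℂ} (ha : Differentiable ℂ a) (hb : Differentiable ℂ b)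
    {A P : ℝ} (haA : ∀ t : ℂ, ‖t‖ ≤ 3 → Real.posLog ‖a t‖ ≤ A)
    (hP : ∀ t : ℂ, ‖t‖ ≤ 3 → Real.posLog ‖a t‖ + Real.posLog ‖b t‖ ≤ P) :
    2 * A - P ≤ 4 * (A - Real.log ‖a 1‖) + (A - Real.log ‖b 0‖) := by
  have hInt : ∀ {k : ℂ → ℂ}, Differentiable ℂ k → ∀ (c : ℂ) (R : ℝ),
      IntegrableOn (fun t => Real.posLog ‖k t‖) (Metric.ball c R) := fun hk c R =>
    ((Real.continuous_posLog.comp hk.continuous.norm).continuousOn.integrableOn_compact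
      (isCompact_closedBall c R)).mono_set Metric.ball_subset_closedBall
  have hconst : ∀ (x : ℝ) (c : ℂ) (R : ℝ), IntegrableOn (fun _ => x) (Metric.ball c R) :=
    fun x c R => integrableOn_const measure_ball_lt_top.ne
  have hvol : ∀ (x : ℝ) (c : ℂ) {R : ℝ}, 0 ≤ R →
      ∫ _ in Metric.ball c R, x = R ^ 2 * Real.pi * x := by
    intro x c R hR
    rw [setIntegral_const, smul_eq_mul, measureReal_def, Complex.volume_ball]
    simp [ENNReal.toReal_ofReal hR]
  have hdiff : ∀ {k : ℂ → ℂ}, Differentiable ℂ k → ∀ (c : ℂ) (R : ℝ),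
      IntegrableOn (fun t => A - Real.posLog ‖k t‖) (Metric.ball c R) := fun hk c R =>
    (hconst A c R).sub (hInt hk c R)
  have h1 := log_norm_mul_le_setIntegral_posLog ha 1 zero_le_two
  have h2 := log_norm_mul_le_setIntegral_posLog hb 0 zero_le_one
  have h12 : ∀ t ∈ Metric.ball (1 : ℂ) 2, ‖t‖ ≤ 3 := by
    intro t ht
    rw [Metric.mem_ball, dist_eq_norm] at ht
    calc ‖t‖ = ‖(t - 1) + 1‖ := by ring_nf
      _ ≤ ‖t - 1‖ + ‖(1 : ℂ)‖ := norm_add_le _ _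
      _ ≤ 3 := by rw [norm_one]; linarith
  have hsub : Metric.ball (0 : ℂ) 1 ⊆ Metric.ball 1 2 :=
    Metric.ball_subset_ball' (by simp; norm_num)
  have h01 : ∀ t ∈ Metric.ball (0 : ℂ) 1, ‖t‖ ≤ 3 := fun t ht => h12 t (hsub ht)
  -- Since `A - log⁺ ‖a‖` is nonnegative, the unit disc at 0 may be enlarged to the disc of radius 2
  -- at 1, where the sub-mean value inequality is centred at `a 1`. The ratio of areas is the factor
  -- 4.
  have h3 : ∫ t in Metric.ball (0 : ℂ) 1, (A - Real.posLog ‖a t‖)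
      ≤ ∫ t in Metric.ball (1 : ℂ) 2, (A - Real.posLog ‖a t‖) := by
    refine setIntegral_mono_set (hdiff ha 1 2) ?_ hsub.eventuallyLE
    refine (ae_restrict_iff' measurableSet_ball).2 (Filter.Eventually.of_forall fun t ht => ?_)
    exact sub_nonneg.2 (haA t (h12 t ht))
  have h4 : ∫ _ in Metric.ball (0 : ℂ) 1, (2 * A - P)
      ≤ ∫ t in Metric.ball (0 : ℂ) 1, ((A - Real.posLog ‖a t‖) + (A - Real.posLog ‖b t‖)) := by
    refine setIntegral_mono_on (hconst _ 0 1) ((hdiff ha 0 1).add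
      (hdiff hb 0 1)) measurableSet_ball fun t ht => ?_
    have := hP t (h01 t ht)
    linarith
  rw [integral_add (hdiff ha 0 1) (hdiff hb 0 1),
    integral_sub (hconst A 0 1) (hInt hb 0 1), hvol _ _ zero_le_one, hvol _ _ zero_le_one] at h4
  rw [integral_sub (hconst A 1 2) (hInt ha 1 2), hvol _ _ zero_le_two] at h3
  have hpi := Real.pi_pos
  have h5 : Real.pi * (2 * A - P)
      ≤ Real.pi * (4 * (A - Real.log ‖a 1‖) + (A - Real.log ‖b 0‖)) := by linarith
  exact le_of_mul_le_mul_left h5 hpi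

/-! ### Mutual domination forces boundedness. -/

/-- If `u` is dominated by Gaussian averages of `f`, and the product `f u` by Gaussian averages of
`f` and `u`, then a bound `exp (ε |z|² + K)` for `f` and `u` improves for `u`. -/
theorem growth_improvement {n : ℕ} {f u : (Fin n → ℂ) → ℂ} (hf : Differentiable ℂ f)
    (hu : Differentiable ℂ u) {C ε K : ℝ} (hε : 0 < ε) (hε1 : ε ≤ 1 / 10 ^ 6)
    (hK : 100 * C ≤ K) (hK0 : 0 < K)
    (hdom : ∀ Y, 0 ≤ Y → ∀ z, (∀ ζ, ‖f (z + ζ)‖ ≤ Real.exp (Y + normSq ζ / 4)) →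
      ‖u z‖ ≤ Real.exp (Y + C))
    (hprod : ∀ Y, 0 ≤ Y → ∀ z, (∀ ζ, ‖f (z + ζ)‖ ≤ Real.exp (Y + normSq ζ / 4)) →
      (∀ ζ, ‖u (z + ζ)‖ ≤ Real.exp (Y + normSq ζ / 4)) → ‖f z‖ * ‖u z‖ ≤ Real.exp (Y + C))
    (hfE : ∀ z, ‖f z‖ ≤ Real.exp (ε * normSq z + K))
    (huE : ∀ z, ‖u z‖ ≤ Real.exp (ε * normSq z + K)) (z : Fin n → ℂ) :
    ‖u z‖ ≤ Real.exp (9 / 10 * (ε * normSq z + K)) := by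
  by_contra! hcon
  set X := ε * normSq z + K with hX
  have hεz : 0 ≤ ε * normSq z := mul_nonneg hε.le (normSq_nonneg z)
  have hX0 : 0 < X := by positivity
  have hCX : C ≤ X / 100 := by linarith
  -- If `u` is large at `z`, domination makes `f` large at some `z + ζ`. The global bound on `f`
  -- then keeps `normSq ζ` of order `X`, so for small `ε` the exponent hardly changes on the disc
  -- `‖t‖ ≤ 3` of the line `z + t • ζ`.
  obtain ⟨ζ, hζ⟩ : ∃ ζ, Real.exp (9 / 10 * X - C + normSq ζ / 4) < ‖f (z + ζ)‖ := by
    by_contra! h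
    have := hdom (9 / 10 * X - C) (by linarith) z h
    rw [sub_add_cancel] at this
    exact absurd this (not_le.2 hcon)
  have hqζ := normSq_nonneg ζ
  have hζX : normSq ζ ≤ 16 * X := by
    have h1 := Real.exp_lt_exp.1 (hζ.trans_le (hfE (z + ζ)))
    have h2 := normSq_add_le z ζ one_pos
    have h3 := mul_le_mul_of_nonneg_left h2 hε.le
    have h4 : ε * normSq ζ ≤ 1 / 10 ^ 6 * normSq ζ := mul_le_mul_of_nonneg_right hε1 hqζ
    norm_num at h3 h4
    nlinarith
  have hline : ∀ t : ℂ, ‖t‖ ≤ 3 → ε * normSq (z + t • ζ) + K ≤ 21 / 20 * X := by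
    intro t ht
    have h2 := normSq_add_le z (t • ζ) (a := 1 / 50) (by norm_num)
    rw [normSq_smul] at h2
    have h3 := mul_le_mul_of_nonneg_left h2 hε.le
    have h5 : ‖t‖ ^ 2 * normSq ζ ≤ 9 * (16 * X) := by
      refine mul_le_mul ?_ hζX hqζ (by norm_num)
      nlinarith [norm_nonneg t]
    have h6 : ε * (‖t‖ ^ 2 * normSq ζ) ≤ 1 / 10 ^ 6 * (9 * (16 * X)) :=
      mul_le_mul hε1 h5 (by positivity) (by norm_num)
    norm_num at h3 h6
    nlinarith
  have hnear : ∀ t : ℂ, ‖t‖ ≤ 3 → ∀ ξ : Fin n → ℂ,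
      ε * normSq (z + t • ζ + ξ) + K ≤ 27 / 25 * X + normSq ξ / 4 := by
    intro t ht ξ
    have h1 := hline t ht
    have h2 := normSq_add_le (z + t • ζ) ξ (a := 1 / 50) (by norm_num)
    have h3 := mul_le_mul_of_nonneg_left h2 hε.le
    have hqξ := normSq_nonneg ξ
    have h4 : ε * normSq ξ ≤ 1 / 10 ^ 6 * normSq ξ := mul_le_mul_of_nonneg_right hε1 hqξ
    norm_num at h3 h4
    nlinarith
  have hpr : ∀ t : ℂ, ‖t‖ ≤ 3 → ‖f (z + t • ζ)‖ * ‖u (z + t • ζ)‖ ≤ Real.exp (109 / 100 * X) := by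
    intro t ht
    refine (hprod (27 / 25 * X) (by positivity) _
      (fun ξ => (hfE _).trans (Real.exp_le_exp.2 (hnear t ht ξ)))
      (fun ξ => (huE _).trans (Real.exp_le_exp.2 (hnear t ht ξ)))).trans (Real.exp_le_exp.2 ?_)
    linarith
  have hfA : ∀ t : ℂ, ‖t‖ ≤ 3 → ‖f (z + t • ζ)‖ ≤ Real.exp (21 / 20 * X) := fun t ht =>
    (hfE _).trans (Real.exp_le_exp.2 (hline t ht))
  have huA : ∀ t : ℂ, ‖t‖ ≤ 3 → ‖u (z + t • ζ)‖ ≤ Real.exp (21 / 20 * X) := fun t ht =>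
    (huE _).trans (Real.exp_le_exp.2 (hline t ht))
  have hAP : Real.exp (21 / 20 * X) ≤ Real.exp (109 / 100 * X) :=
    Real.exp_le_exp.2 (by linarith)
  -- In units of `X`, the left side is `2 * 1.05 - 1.09 = 1.01`, while the lower bounds `0.89` for
  -- `log ‖f (z + ζ)‖` and `0.9` for `log ‖u z‖` make the right side at most `4 * 0.16 + 0.15 =
  -- 0.79`.
  have hmain := posLog_two_discs (a := fun t => f (z + t • ζ)) (b := fun t => u (z + t • ζ))
    (by fun_prop) (by fun_prop) (A := 21 / 20 * X) (P := 109 / 100 * X)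
    (fun t ht => posLog_le_of_le_exp (norm_nonneg _) (by positivity) (hfA t ht))
    (fun t ht => posLog_add_posLog_le (norm_nonneg _) (norm_nonneg _) (by positivity)
      ((hfA t ht).trans hAP) ((huA t ht).trans hAP) (hpr t ht))
  simp only [one_smul, zero_smul, add_zero] at hmain
  have hl1 : 89 / 100 * X ≤ Real.log ‖f (z + ζ)‖ := by
    rw [Real.le_log_iff_exp_le ((Real.exp_pos _).trans hζ)]
    exact (Real.exp_le_exp.2 (by linarith)).trans hζ.le
  have hl2 : 9 / 10 * X ≤ Real.log ‖u z‖ := by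
    rw [Real.le_log_iff_exp_le ((Real.exp_pos _).trans hcon)]
    exact hcon.le
  linarith

/-- Two slowly growing entire functions that dominate each other in Gaussian average, and whose
product is dominated as well, are bounded. -/
theorem exists_bound_of_mutual_domination {n : ℕ} {f u : (Fin n → ℂ) → ℂ}
    (hf : Differentiable ℂ f) (hfs : SlowGrowth f) (hu : Differentiable ℂ u) (hus : SlowGrowth u)
    {C : ℝ} (hC : 0 ≤ C)
    (hfu : ∀ Y, 0 ≤ Y → ∀ z, (∀ ζ, ‖f (z + ζ)‖ ≤ Real.exp (Y + normSq ζ / 4)) →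
      ‖u z‖ ≤ Real.exp (Y + C))
    (huf : ∀ Y, 0 ≤ Y → ∀ z, (∀ ζ, ‖u (z + ζ)‖ ≤ Real.exp (Y + normSq ζ / 4)) →
      ‖f z‖ ≤ Real.exp (Y + C))
    (hprod : ∀ Y, 0 ≤ Y → ∀ z, (∀ ζ, ‖u (z + ζ)‖ ≤ Real.exp (Y + normSq ζ / 4)) →
      ‖f z‖ * ‖u z‖ ≤ Real.exp (Y + C)) :
    ∃ M, ∀ z, ‖u z‖ ≤ M := by
  obtain ⟨D, hD0, hD⟩ := hfs.exists_nonneg (c := 1 / 10 ^ 6) (by norm_num)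
  obtain ⟨D', hD0', hD'⟩ := hus.exists_nonneg (c := 1 / 10 ^ 6) (by norm_num)
  -- `K` absorbs the constants `D`, `D'` into the exponent and stays fixed while the coefficient of
  -- `normSq z` shrinks by `9 / 10` at each step.
  set K := 100 * C + D + D' + 1 with hKdef
  have hexp : ∀ {x : ℝ}, x ≤ K → ∀ y, x * Real.exp y ≤ Real.exp (y + K) := by
    intro x hx y
    rw [add_comm, Real.exp_add]
    refine mul_le_mul_of_nonneg_right ?_ (Real.exp_pos _).le
    exact hx.trans ((le_add_of_nonneg_right zero_le_one).trans (Real.add_one_le_exp K))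
  have key : ∀ k : ℕ, ∀ z, ‖f z‖ ≤ Real.exp ((9 / 10) ^ k * (1 / 10 ^ 6) * normSq z + K) ∧
      ‖u z‖ ≤ Real.exp ((9 / 10) ^ k * (1 / 10 ^ 6) * normSq z + K) := by
    intro k
    induction k with
    | zero =>
      intro z
      rw [pow_zero, one_mul]
      exact ⟨(hD z).trans (hexp (by linarith) _), (hD' z).trans (hexp (by linarith) _)⟩
    | succ k ih =>
      have hε : (0 : ℝ) < (9 / 10) ^ k * (1 / 10 ^ 6) := by positivity
      have hε1 : (9 / 10 : ℝ) ^ k * (1 / 10 ^ 6) ≤ 1 / 10 ^ 6 :=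
        mul_le_of_le_one_left (by norm_num) (pow_le_one₀ (by norm_num) (by norm_num))
      have hle : ∀ z : Fin n → ℂ, 9 / 10 * ((9 / 10) ^ k * (1 / 10 ^ 6) * normSq z + K)
          ≤ (9 / 10) ^ (k + 1) * (1 / 10 ^ 6) * normSq z + K := fun z => by
        have hK0 : 0 ≤ K := by positivity
        rw [pow_succ' (9 / 10 : ℝ) k, mul_add, ← mul_assoc, ← mul_assoc]
        linarith
      intro z
      refine ⟨?_, ?_⟩
      -- The product bound needs control of `u` only. As `growth_improvement` offers control of both
      -- functions, it serves in both roles.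
      · exact (growth_improvement hu hf hε hε1 (by linarith) (by linarith) huf
          (fun Y hY z h _ => by rw [mul_comm]; exact hprod Y hY z h)
          (fun z => (ih z).2) (fun z => (ih z).1) z).trans (Real.exp_le_exp.2 (hle z))
      · exact (growth_improvement hf hu hε hε1 (by linarith) (by linarith) hfu
          (fun Y hY z _ h => hprod Y hY z h)
          (fun z => (ih z).1) (fun z => (ih z).2) z).trans (Real.exp_le_exp.2 (hle z))
  refine ⟨Real.exp K, fun z => ?_⟩
  have hlim : Filter.Tendsto
      (fun k : ℕ => Real.exp ((9 / 10 : ℝ) ^ k * (1 / 10 ^ 6) * normSq z + K)) Filter.atTop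
      (nhds (Real.exp (0 * (1 / 10 ^ 6) * normSq z + K))) := by
    refine (Real.continuous_exp.tendsto _).comp ?_
    exact (((tendsto_pow_atTop_nhds_zero_of_lt_one (by norm_num) (by norm_num)).mul_const
      _).mul_const _).add_const K
  rw [zero_mul, zero_mul, zero_add] at hlim
  exact ge_of_tendsto' hlim fun k => (key k z).2

/-! ### The kernel identity and its inverse. -/

theorem continuous_conj_comp {n : ℕ} {h : (Fin n → ℂ) → ℂ} (hh : Differentiable ℂ h) :
    Continuous fun z => conj (h z) := Complex.continuous_conj.comp hh.continuous

theorem integral_translate {n : ℕ} {h : (Fin n → ℂ) → ℂ} (hd : Differentiable ℂ h)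
    (hs : SlowGrowth h) (a : Fin n → ℂ) (s : ℂ) :
    ∫ ξ, h (a + s • ξ) ∂(gaussian n) = h a := by
  have := integral_gaussian_of_differentiable (h := fun ξ => h (a + s • ξ)) (by fun_prop)
    (hs.comp_affine a s)
  simpa using this

theorem integral_conj_translate {n : ℕ} {h : (Fin n → ℂ) → ℂ} (hd : Differentiable ℂ h)
    (hs : SlowGrowth h) (a : Fin n → ℂ) (s : ℂ) :
    ∫ ξ, conj (h (a + s • ξ)) ∂(gaussian n) = conj (h a) := by
  rw [integral_conj, integral_translate hd hs]

theorem integrable_translate_mul_conj {n : ℕ} {u g : (Fin n → ℂ) → ℂ} (hu : Differentiable ℂ u)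
    (hus : SlowGrowth u) (hg : Differentiable ℂ g) (hgs : SlowGrowth g) (z w : Fin n → ℂ) (s : ℂ) :
    Integrable (fun ζ => u (z + ζ) * conj (g (w + s • ζ))) (gaussian n) := by
  have hu1 : SlowGrowth fun ζ => u (z + ζ) := by simpa using hus.comp_affine z 1
  refine (hu1.mul (hgs.comp_affine w s).star).integrable ?_
  exact (hu.continuous.comp (continuous_const.add continuous_id)).mul
    (continuous_conj_comp (h := fun ζ => g (w + s • ζ)) (by fun_prop))

/-- The Toeplitz operator with symbol `f + ḡ` applied to `h K_w`. -/
theorem toeplitz_mul_kernel {n : ℕ} {f g h : (Fin n → ℂ) → ℂ} (hf : Differentiable ℂ f)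
    (hfs : SlowGrowth f) (hg : Differentiable ℂ g) (hgs : SlowGrowth g) (hh : Differentiable ℂ h)
    (hhs : SlowGrowth h) (w z : Fin n → ℂ) :
    toeplitz (fun z => f z + conj (g z)) (fun z => h z * kernel z w) z
      = (f z * h z + ∫ ζ, h (ζ + z) * conj (g (ζ + w)) ∂(gaussian n)) * kernel z w := by
  have hk := differentiable_kernel w
  have h1 := integral_mul_kernel (h := fun ζ => f ζ * h ζ * kernel ζ w) (by fun_prop)
    ((hfs.mul hhs).mul (.kernel w)) z
  have h2 := integral_mul_conj_mul_kernel hh hhs hg hgs z w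
  have hkz : Continuous fun ζ => kernel z ζ := by
    simpa only [conj_kernel] using continuous_conj_comp (differentiable_kernel z)
  have hgc := continuous_conj_comp hg
  have hfc := hf.continuous
  have hhc := hh.continuous
  have hkc := hk.continuous
  have i1 : Integrable (fun ζ => f ζ * h ζ * kernel ζ w * kernel z ζ) (gaussian n) :=
    (((hfs.mul hhs).mul (.kernel w)).mul (.kernel_right z)).integrable (by fun_prop)
  have i2 : Integrable (fun ζ => h ζ * conj (g ζ) * kernel ζ w * kernel z ζ) (gaussian n) :=
    (((hhs.mul hgs.star).mul (.kernel w)).mul (.kernel_right z)).integrable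
      (((hhc.mul hgc).mul hkc).mul hkz)
  have h3 : ∀ ζ : Fin n → ℂ, (f ζ + conj (g ζ)) * (h ζ * kernel ζ w) * kernel z ζ
      = f ζ * h ζ * kernel ζ w * kernel z ζ + h ζ * conj (g ζ) * kernel ζ w * kernel z ζ :=
    fun ζ => by ring
  simp only [toeplitz, projection, h3]
  rw [integral_add i1 i2, h1, h2]
  ring

/-- If `T_φ T_ψ = 0`, then the kernel of `T_φ T_ψ` vanishes. -/
theorem kernel_identity {n : ℕ} {f g u v : (Fin n → ℂ) → ℂ}
    (hf : Differentiable ℂ f) (hfs : SlowGrowth f) (hg : Differentiable ℂ g) (hgs : SlowGrowth g)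
    (hu : Differentiable ℂ u) (hus : SlowGrowth u) (hv : Differentiable ℂ v) (hvs : SlowGrowth v)
    (h0 : ToeplitzProductEqZero (fun z => f z + conj (g z)) (fun z => u z + conj (v z)))
    (z w : Fin n → ℂ) :
    f z * u z + f z * conj (v w) + conj (g w) * conj (v w)
      + ∫ ζ, u (z + ζ) * conj (g (w + ζ)) ∂(gaussian n) = 0 := by
  have hk := differentiable_kernel w
  have hfc := hf.continuous
  have huc := hu.continuous
  have hkc := hk.continuous
  have hgc := continuous_conj_comp hg
  have hvc := continuous_conj_comp hv
  have hT : toeplitz (fun z => u z + conj (v z)) (fun z => kernel z w)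
      = fun z => (u z + conj (v w)) * kernel z w := by
    funext z
    have h1 := toeplitz_mul_kernel hu hus hv hvs (differentiable_const (1 : ℂ)) (.const 1) w z
    have h2 := integral_conj_translate hv hvs w 1
    simp only [one_smul] at h2
    simpa [add_comm _ w, h2] using h1
  have hds : SlowGrowth fun z => (u z + conj (v w)) * kernel z w :=
    (hus.add (.const _)).mul (.kernel w)
  have hdd : Differentiable ℂ fun z => (u z + conj (v w)) * kernel z w := by fun_prop
  have hmem : (fun z => kernel z w) ∈
      productDomain (fun z => f z + conj (g z)) (fun z => u z + conj (v z)) := by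
    refine ⟨⟨⟨hk, (SlowGrowth.kernel w).memLp hkc⟩, ?_⟩, ?_⟩
    · exact ((hus.add hvs.star).mul (.kernel w)).memLp ((huc.add hvc).mul hkc)
    · rw [hT]
      refine ⟨⟨hdd, hds.memLp hdd.continuous⟩, ?_⟩
      exact ((hfs.add hgs.star).mul hds).memLp ((hfc.add hgc).mul hdd.continuous)
  have h1 := congrFun (h0 _ hmem) z
  rw [hT, toeplitz_mul_kernel hf hfs hg hgs (hu.add_const _) (hus.add (.const _)), Pi.zero_apply,
    mul_eq_zero, or_iff_left (kernel_ne_zero z w)] at h1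
  have h2 := integral_conj_translate hg hgs w 1
  have i1 := integrable_translate_mul_conj hu hus hg hgs z w 1
  have i2 := integrable_translate_mul_conj (differentiable_const (conj (v w))) (.const _) hg hgs
    z w 1
  simp only [one_smul] at h2 i1 i2
  simp only [add_comm _ z, add_comm _ w, add_mul] at h1
  rw [integral_add i1 i2, integral_const_mul, h2] at h1
  linear_combination h1

/-- The identity `kernel_identity` with the roles of the mixed terms exchanged. -/
theorem inverse_identity {n : ℕ} {f g u v : (Fin n → ℂ) → ℂ}
    (hf : Differentiable ℂ f) (hfs : SlowGrowth f) (hg : Differentiable ℂ g) (hgs : SlowGrowth g)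
    (hu : Differentiable ℂ u) (hus : SlowGrowth u) (hv : Differentiable ℂ v) (hvs : SlowGrowth v)
    (h0 : ∀ z w, f z * u z + f z * conj (v w) + conj (g w) * conj (v w)
      + ∫ ζ, u (z + ζ) * conj (g (w + ζ)) ∂(gaussian n) = 0) (z w : Fin n → ℂ) :
    f z * u z + u z * conj (g w) + conj (g w) * conj (v w)
      + ∫ ζ, f (z + ζ) * conj (v (w + (-1 : ℂ) • ζ)) ∂(gaussian n) = 0 := by
  -- The averaging over `ξ` leaves `f u` and the conjugate of `g v` unchanged by the mean value
  -- property; only the two mixed terms change.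
  have h1 := integral_integral_translate hu hus hg hgs z w
  have h2 : ∀ ξ : Fin n → ℂ, ∫ ζ, u (ζ + (z + ξ)) * conj (g (ζ + (w - ξ))) ∂(gaussian n)
      = -(f (z + ξ) * u (z + ξ) + f (z + ξ) * conj (v (w + (-1 : ℂ) • ξ))
        + conj (g (w + (-1 : ℂ) • ξ) * v (w + (-1 : ℂ) • ξ))) := by
    intro ξ
    have h3 := h0 (z + ξ) (w - ξ)
    simp only [add_comm _ (z + ξ), add_comm _ (w - ξ)]
    rw [neg_one_smul, ← sub_eq_add_neg, map_mul]
    linear_combination h3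
  have hfu : Differentiable ℂ fun z => f z * u z := hf.mul hu
  have hgv : Differentiable ℂ fun z => g z * v z := hg.mul hv
  have i1 : Integrable (fun ξ => f (z + ξ) * u (z + ξ)) (gaussian n) := by
    have := ((hfs.mul hus).comp_affine z 1).integrable (by
      have := hf.continuous
      have := hu.continuous
      fun_prop)
    simpa using this
  have i2 := integrable_translate_mul_conj hf hfs hv hvs z w (-1)
  have i12 : Integrable (fun ξ => f (z + ξ) * u (z + ξ)
      + f (z + ξ) * conj (v (w + (-1 : ℂ) • ξ))) (gaussian n) := i1.add i2
  have i3 : Integrable (fun ξ => conj (g (w + (-1 : ℂ) • ξ) * v (w + (-1 : ℂ) • ξ)))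
      (gaussian n) :=
    ((hgs.mul hvs).comp_affine w (-1)).star.integrable
      (continuous_conj_comp (h := fun ξ => g (w + (-1 : ℂ) • ξ) * v (w + (-1 : ℂ) • ξ))
        (by fun_prop))
  have e1 := integral_translate hfu (hfs.mul hus) z 1
  have e3 := integral_conj_translate hgv (hgs.mul hvs) w (-1)
  simp only [one_smul] at e1
  simp only [h2] at h1
  rw [integral_neg, integral_add i12 i3, integral_add i1 i2, e1, e3, map_mul] at h1
  linear_combination -h1

/-! ### Domination from the identities, and the conclusion. -/

theorem norm_integral_mul_le_exp {n : ℕ} {F G : (Fin n → ℂ) → ℂ} (hG : Continuous G)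
    (hGs : SlowGrowth G) {Y : ℝ} (hF : ∀ ζ, ‖F ζ‖ ≤ Real.exp (Y + normSq ζ / 4)) :
    ‖∫ ζ, F ζ * G ζ ∂(gaussian n)‖
      ≤ Real.exp Y * ∫ ζ, Real.exp (normSq ζ / 4) * ‖G ζ‖ ∂(gaussian n) := by
  have hq := continuous_normSq (n := n)
  obtain ⟨C, hC⟩ := hGs (1 / 4) (by norm_num)
  have hi : Integrable (fun ζ => Real.exp (normSq ζ / 4) * ‖G ζ‖) (gaussian n) := by
    refine ((integrable_exp_mul_normSq (n := n) (c := 1 / 2) (by norm_num)).const_mul C).mono'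
      (by fun_prop : Continuous _).aestronglyMeasurable (Filter.Eventually.of_forall fun ζ => ?_)
    rw [Real.norm_of_nonneg (by positivity)]
    refine (mul_le_mul_of_nonneg_left (hC ζ) (Real.exp_pos _).le).trans_eq ?_
    rw [mul_left_comm, ← Real.exp_add]
    ring_nf
  rw [← integral_const_mul]
  refine norm_integral_le_of_norm_le (hi.const_mul _) (Filter.Eventually.of_forall fun ζ => ?_)
  rw [norm_mul, ← mul_assoc, ← Real.exp_add]
  exact mul_le_mul_of_nonneg_right (hF ζ) (norm_nonneg _)

/-- If `a(z) c̄(w)` is, up to terms depending on `z` only or on `w` only, the Gaussian pairing of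
translates of `b` and `d`, then `a` is dominated by Gaussian averages of `b`, provided that `c` is
not constant. -/
theorem exists_domination {n : ℕ} {a b c d p q : (Fin n → ℂ) → ℂ} (hd : Differentiable ℂ d)
    (hds : SlowGrowth d) {s : ℂ}
    (h : ∀ z w, p z + a z * conj (c w) + q w
      + ∫ ζ, b (z + ζ) * conj (d (w + s • ζ)) ∂(gaussian n) = 0)
    {w₁ w₂ : Fin n → ℂ} (hc : c w₁ ≠ c w₂) :
    ∃ C, 0 ≤ C ∧ ∀ Y, 0 ≤ Y → ∀ z, (∀ ζ, ‖b (z + ζ)‖ ≤ Real.exp (Y + normSq ζ / 4)) →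
      ‖a z‖ ≤ Real.exp (Y + C) := by
  set I : (Fin n → ℂ) → ℝ := fun w =>
    ∫ ζ, Real.exp (normSq ζ / 4) * ‖conj (d (w + s • ζ))‖ ∂(gaussian n)
  have hI0 : ∀ w, 0 ≤ I w := fun w => integral_nonneg fun ζ => by positivity
  have hδ : 0 < ‖conj (c w₁) - conj (c w₂)‖ := by
    rw [← map_sub, RCLike.norm_conj]
    exact norm_pos_iff.2 (sub_ne_zero.2 hc)
  set δ := ‖conj (c w₁) - conj (c w₂)‖
  set B := ‖q w₂ - q w₁‖ + I w₂ + I w₁ with hB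
  have hB0 : 0 ≤ B := add_nonneg (add_nonneg (norm_nonneg _) (hI0 _)) (hI0 _)
  refine ⟨B / δ, by positivity, fun Y hY z hb => ?_⟩
  have hInt : ∀ w, ‖∫ ζ, b (z + ζ) * conj (d (w + s • ζ)) ∂(gaussian n)‖ ≤ Real.exp Y * I w :=
    fun w => norm_integral_mul_le_exp
      (Complex.continuous_conj.comp (hd.continuous.comp (by fun_prop)))
      (hds.comp_affine w s).star hb
  -- Subtracting the relations at `w₁` and `w₂` eliminates the uncontrolled term `p z`.
  have h1 : a z * (conj (c w₁) - conj (c w₂)) = (q w₂ - q w₁)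
      + ∫ ζ, b (z + ζ) * conj (d (w₂ + s • ζ)) ∂(gaussian n)
      - ∫ ζ, b (z + ζ) * conj (d (w₁ + s • ζ)) ∂(gaussian n) := by
    linear_combination h z w₁ - h z w₂
  have h2 : ‖a z‖ * δ ≤ Real.exp Y * B := by
    rw [← norm_mul, h1]
    refine (norm_sub_le _ _).trans ((add_le_add_left (norm_add_le _ _) _).trans ?_)
    have h3 : ‖q w₂ - q w₁‖ ≤ Real.exp Y * ‖q w₂ - q w₁‖ :=
      le_mul_of_one_le_left (norm_nonneg _) (Real.one_le_exp hY)
    rw [hB, mul_add, mul_add]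
    exact add_le_add (add_le_add h3 (hInt w₂)) (hInt w₁)
  rw [Real.exp_add]
  calc ‖a z‖ ≤ Real.exp Y * B / δ := (le_div_iff₀ hδ).2 h2
    _ = Real.exp Y * (B / δ) := mul_div_assoc _ _ _
    _ ≤ Real.exp Y * Real.exp (B / δ) := by
      refine mul_le_mul_of_nonneg_left ?_ (Real.exp_pos _).le
      exact (le_add_of_nonneg_right zero_le_one).trans (Real.add_one_le_exp _)

/-- An entire function on `ℂⁿ` that is constant near a point is constant. -/
theorem eq_const_of_eventually_eq {n : ℕ} {h : (Fin n → ℂ) → ℂ} (hh : Differentiable ℂ h)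
    {z₀ : Fin n → ℂ} {c : ℂ} (hc : ∀ᶠ z in nhds z₀, h z = c) (z : Fin n → ℂ) : h z = c := by
  have hk : Differentiable ℂ fun t : ℂ => h (z₀ + t • (z - z₀)) := by fun_prop
  have hk' : AnalyticOnNhd ℂ (fun t : ℂ => h (z₀ + t • (z - z₀))) Set.univ :=
    fun t _ => hk.analyticAt t
  have ht : Filter.Tendsto (fun t : ℂ => z₀ + t • (z - z₀)) (nhds 0) (nhds z₀) := by
    have : Continuous fun t : ℂ => z₀ + t • (z - z₀) := by fun_prop
    simpa using this.tendsto 0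
  have := hk'.eq_of_eventuallyEq (g := fun _ => c) (fun _ _ => analyticAt_const) (z₀ := 0)
    (ht.eventually hc)
  simpa using congrFun this 1

theorem eq_zero_or_eq_zero_of_polarized_mul_eq_zero {n : ℕ} {f g u v : (Fin n → ℂ) → ℂ}
    (hf : Differentiable ℂ f) (hg : Differentiable ℂ g) (hu : Differentiable ℂ u)
    (hv : Differentiable ℂ v) (h : ∀ z w, (f z + conj (g w)) * (u z + conj (v w)) = 0) :
    (fun z => f z + conj (g z)) = 0 ∨ (fun z => u z + conj (v z)) = 0 := by
  refine or_iff_not_imp_left.2 fun hφ => ?_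
  obtain ⟨z₀, hz₀⟩ := Function.ne_iff.1 hφ
  have hz₀' : f z₀ + conj (g z₀) ≠ 0 := hz₀
  have hgc : Continuous fun w => conj (g w) := Complex.continuous_conj.comp hg.continuous
  -- In the polarized identity the two variables are free: freezing one at `z₀` keeps the first
  -- factor nonzero while the other varies near `z₀`.
  have h1 : ∀ᶠ z in nhds z₀, u z = -conj (v z₀) := by
    have hc : Continuous fun z => f z + conj (g z₀) := hf.continuous.add continuous_const
    filter_upwards [hc.continuousAt.eventually_ne hz₀'] with z hz
    exact eq_neg_of_add_eq_zero_left ((mul_eq_zero.1 (h z z₀)).resolve_left hz)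
  have h2 : ∀ᶠ w in nhds z₀, v w = -conj (u z₀) := by
    have hc : Continuous fun w => f z₀ + conj (g w) := continuous_const.add hgc
    filter_upwards [hc.continuousAt.eventually_ne hz₀'] with w hw
    have h3 := eq_neg_of_add_eq_zero_right ((mul_eq_zero.1 (h z₀ w)).resolve_left hw)
    rw [← Complex.conj_conj (v w), h3, map_neg]
  have hu1 := eq_const_of_eventually_eq hu h1
  have hv1 := eq_const_of_eventually_eq hv h2
  funext z
  rw [Pi.zero_apply, hu1 z, hv1 z, ← hv1 z₀, neg_add_cancel]

/-- If the kernel identity holds with neither `g` nor `v` constant, then `u` is constant. -/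
theorem eq_of_kernel_identity {n : ℕ} {f g u v : (Fin n → ℂ) → ℂ}
    (hf : Differentiable ℂ f) (hfs : SlowGrowth f) (hg : Differentiable ℂ g) (hgs : SlowGrowth g)
    (hu : Differentiable ℂ u) (hus : SlowGrowth u) (hv : Differentiable ℂ v) (hvs : SlowGrowth v)
    (h0 : ∀ z w, f z * u z + f z * conj (v w) + conj (g w) * conj (v w)
      + ∫ ζ, u (z + ζ) * conj (g (w + ζ)) ∂(gaussian n) = 0)
    {w₁ w₂ : Fin n → ℂ} (hgw : g w₁ ≠ g w₂) {w₃ w₄ : Fin n → ℂ} (hvw : v w₃ ≠ v w₄)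
    (z z' : Fin n → ℂ) : u z = u z' := by
  have hinv := inverse_identity hf hfs hg hgs hu hus hv hvs h0
  have h0' : ∀ z w, f z * u z + f z * conj (v w) + conj (g w) * conj (v w)
      + ∫ ζ, u (z + ζ) * conj (g (w + (1 : ℂ) • ζ)) ∂(gaussian n) = 0 := by
    simpa only [one_smul] using h0
  obtain ⟨C₁, hC₁, hfu⟩ := exists_domination (a := u) (b := f) (c := g) (p := fun z => f z * u z)
    (q := fun w => conj (g w) * conj (v w)) hv hvs hinv hgw
  obtain ⟨C₂, hC₂, huf⟩ := exists_domination (a := f) (b := u) (c := v) (p := fun z => f z * u z)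
    (q := fun w => conj (g w) * conj (v w)) hg hgs h0' hvw
  set I := ∫ ζ, Real.exp (normSq ζ / 4) * ‖conj (g (0 + (1 : ℂ) • ζ))‖ ∂(gaussian n)
  have hI0 : 0 ≤ I := integral_nonneg fun ζ => by positivity
  set D := ‖v 0‖ + ‖g 0‖ * ‖v 0‖ + I with hD
  have hD0 : 0 ≤ D := by positivity
  have hle : ∀ {Y C x : ℝ}, C ≤ C₁ + C₂ + D → x ≤ Real.exp (Y + C) →
      x ≤ Real.exp (Y + (C₁ + C₂ + D)) := fun h hx =>
    hx.trans (Real.exp_le_exp.2 (by linarith))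
  have hprod : ∀ Y, 0 ≤ Y → ∀ z, (∀ ζ, ‖u (z + ζ)‖ ≤ Real.exp (Y + normSq ζ / 4)) →
      ‖f z‖ * ‖u z‖ ≤ Real.exp (Y + (C₂ + D)) := by
    intro Y hY z hb
    have h1 := huf Y hY z hb
    have h2 : ‖∫ ζ, u (z + ζ) * conj (g (0 + (1 : ℂ) • ζ)) ∂(gaussian n)‖ ≤ Real.exp Y * I :=
      norm_integral_mul_le_exp
        (Complex.continuous_conj.comp (hg.continuous.comp (by fun_prop)))
        (hgs.comp_affine 0 1).star hb
    -- At `w = 0` the identity expresses `f u` through `f` and an average of `u`; `f` is itself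
    -- dominated by `u`, so bounds on `u` alone suffice.
    have h3 : f z * u z = -(f z * conj (v 0) + conj (g 0) * conj (v 0)
        + ∫ ζ, u (z + ζ) * conj (g (0 + (1 : ℂ) • ζ)) ∂(gaussian n)) := by
      linear_combination h0' z 0
    have hYC : Real.exp Y ≤ Real.exp (Y + C₂) := Real.exp_le_exp.2 (by linarith)
    have h1Y : 1 ≤ Real.exp (Y + C₂) := Real.one_le_exp (by linarith)
    have h4 : ‖f z‖ * ‖u z‖ ≤ Real.exp (Y + C₂) * D := by
      rw [← norm_mul, h3, norm_neg, hD, mul_add, mul_add]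
      refine (norm_add_le _ _).trans (add_le_add ((norm_add_le _ _).trans (add_le_add ?_ ?_)) ?_)
      · rw [norm_mul, RCLike.norm_conj]
        exact mul_le_mul_of_nonneg_right h1 (norm_nonneg _)
      · rw [norm_mul, RCLike.norm_conj, RCLike.norm_conj]
        exact le_mul_of_one_le_left (by positivity) h1Y
      · exact h2.trans (mul_le_mul_of_nonneg_right hYC hI0)
    refine h4.trans ?_
    rw [← add_assoc, Real.exp_add (Y + C₂)]
    refine mul_le_mul_of_nonneg_left ?_ (Real.exp_pos _).le
    exact (le_add_of_nonneg_right zero_le_one).trans (Real.add_one_le_exp _)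
  obtain ⟨M, hM⟩ := exists_bound_of_mutual_domination hf hfs hu hus (C := C₁ + C₂ + D)
    (by positivity)
    (fun Y hY z h => hle (by linarith) (hfu Y hY z h))
    (fun Y hY z h => hle (by linarith) (huf Y hY z h))
    (fun Y hY z h => hle (by linarith) (hprod Y hY z h))
  refine hu.apply_eq_apply_of_bounded (isBounded_iff_forall_norm_le.2 ⟨M, ?_⟩) z z'
  rintro _ ⟨x, rfl⟩
  exact hM x

/-- The kernel identity forces one of the two symbols to vanish. -/
theorem eq_zero_or_eq_zero_of_kernel_identity {n : ℕ} {f g u v : (Fin n → ℂ) → ℂ}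
    (hf : Differentiable ℂ f) (hfs : SlowGrowth f) (hg : Differentiable ℂ g) (hgs : SlowGrowth g)
    (hu : Differentiable ℂ u) (hus : SlowGrowth u) (hv : Differentiable ℂ v) (hvs : SlowGrowth v)
    (h0 : ∀ z w, f z * u z + f z * conj (v w) + conj (g w) * conj (v w)
      + ∫ ζ, u (z + ζ) * conj (g (w + ζ)) ∂(gaussian n) = 0) :
    (fun z => f z + conj (g z)) = 0 ∨ (fun z => u z + conj (v z)) = 0 := by
  refine eq_zero_or_eq_zero_of_polarized_mul_eq_zero hf hg hu hv fun z w => ?_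
  have hpair : (∫ ζ, u (z + ζ) * conj (g (w + ζ)) ∂(gaussian n) = u z * conj (g w)) →
      (f z + conj (g w)) * (u z + conj (v w)) = 0 := fun h => by
    linear_combination h0 z w - h
  by_cases hgc : ∀ w₁ w₂, g w₁ = g w₂
  · refine hpair ?_
    simp only [fun ζ => hgc (w + ζ) w]
    have := integral_translate hu hus z 1
    simp only [one_smul] at this
    rw [integral_mul_const, this]
  by_cases hvc : ∀ w₁ w₂, v w₁ = v w₂
  -- For constant `v` the pairing of `f` with `v` in the inverse identity becomes a product, giving
  -- the same factorization.
  · have h1 := inverse_identity hf hfs hg hgs hu hus hv hvs h0 z w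
    have h2 : ∫ ζ, f (z + ζ) * conj (v (w + (-1 : ℂ) • ζ)) ∂(gaussian n) = f z * conj (v w) := by
      simp only [fun ζ : Fin n → ℂ => hvc (w + (-1 : ℂ) • ζ) w]
      have := integral_translate hf hfs z 1
      simp only [one_smul] at this
      rw [integral_mul_const, this]
    linear_combination h1 - h2
  push Not at hgc hvc
  obtain ⟨w₁, w₂, hgw⟩ := hgc
  obtain ⟨w₃, w₄, hvw⟩ := hvc
  have huc := eq_of_kernel_identity hf hfs hg hgs hu hus hv hvs h0 hgw hvw
  refine hpair ?_
  simp only [fun ζ => huc (z + ζ) z]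
  have := integral_conj_translate hg hgs w 1
  simp only [one_smul] at this
  rw [integral_const_mul, this]

theorem toeplitzProductEqZero_of_left {n : ℕ} (b : (Fin n → ℂ) → ℂ) :
    ToeplitzProductEqZero 0 b := fun h _ => by
  funext z
  simp [toeplitz, projection]

theorem toeplitzProductEqZero_of_right {n : ℕ} (a : (Fin n → ℂ) → ℂ) :
    ToeplitzProductEqZero a 0 := fun h _ => by
  funext z
  simp [toeplitz, projection]

end Fock

theorem corollaryc3 (n : ℕ) (f g u v φ ψ : (Fin n → ℂ) → ℂ)
    (hf : f ∈ Fock.symbolClass n) (hf' : Differentiable ℂ f)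
    (hg : g ∈ Fock.symbolClass n) (hg' : Differentiable ℂ g)
    (hu : u ∈ Fock.symbolClass n) (hu' : Differentiable ℂ u)
    (hv : v ∈ Fock.symbolClass n) (hv' : Differentiable ℂ v)
    (hφ : φ = fun z => f z + conj (g z))
    (hψ : ψ = fun z => u z + conj (v z)) :
    Fock.ToeplitzProductEqZero φ ψ ↔ φ = 0 ∨ ψ = 0 := by
  have hfs := Fock.slowGrowth_of_mem_symbolClass hf hf'.continuous
  have hgs := Fock.slowGrowth_of_mem_symbolClass hg hg'.continuous
  have hus := Fock.slowGrowth_of_mem_symbolClass hu hu'.continuous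
  have hvs := Fock.slowGrowth_of_mem_symbolClass hv hv'.continuous
  constructor
  · intro h
    subst hφ hψ
    exact Fock.eq_zero_or_eq_zero_of_kernel_identity hf' hfs hg' hgs hu' hus hv' hvs
      (Fock.kernel_identity hf' hfs hg' hgs hu' hus hv' hvs h)
  · rintro (h | h)
    · rw [h]; exact Fock.toeplitzProductEqZero_of_left ψ
    · rw [h]; exact Fock.toeplitzProductEqZero_of_right φ
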